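/- Let $\phi$ be a pair potential, let $F>0$, let $\phi$ be twice continuously differentiable near $F$ and near $2F$, and put $\phi''_F=\phi''(F)$, $\phi''_{2F}=\phi''(2F)$ and $A_F=\phi''_F+4\phi''_{2F}$. Assume $A_F>0$ and $\phi''_{2F}\neq 0$. For $N\ge 1$ let $\varepsilon=1/N$ and $\mathcal U=\{u\in\mathbb R^{2N+1}: u_{-N}=u_N=0\}$, with components indexed by $-N,\dots,N$. For $1\le p<\infty$ put $\|u\|_{\mathcal U^{1,p}}=\big(\varepsilon\sum_{\ell=-N+1}^{N}|u'_\ell|^p\big)^{1/p}$, where $u'_\ell=\varepsilon^{-1}(u_\ell-u_{\ell-1})$, and for linear $A:\mathcal U\to\mathcal U$ let $\|A\|_{\mathcal U^{1,p}}=\sup_{u\ne0}\|Au\|_{\mathcal U^{1,p}}/\|u\|_{\mathcal U^{1,p}}$. For $-N<j<N$ and $v\in\mathcal U$ define $$(L^{\rm qcl}v)_j=A_F\,\frac{-v_{j+1}+2v_j-v_{j-1}}{\varepsilon^2},$$ $$(L^{\rm a}v)_j=\phi''_F\,\frac{-v_{j+1}+2v_j-v_{j-1}}{\varepsilon^2}+\phi''_{2F}\,\frac{-v_{j+2}+2v_j-v_{j-2}}{\varepsilon^2}\qquad(|j|\le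 N-2),$$ and, for $2\le K\le N/2$, $(L^{\rm qcf}v)_j=(L^{\rm a}v)_j$ if $|j|\le K$ and $(L^{\rm qcf}v)_j=(L^{\rm qcl}v)_j$ if $K<|j|<N$. These are regarded as operators on $\mathcal U$ (with zero boundary values); $L^{\rm qcl}$ is invertible. For $\alpha>0$ let $G_{\rm qcl}=I-\alpha(L^{\rm qcl})^{-1}L^{\rm qcf}$. Then for every $p\in[1,\infty)$ and every $\alpha>0$ we have $\|G_{\rm qcl}\|_{\mathcal U^{1,p}}\sim N^{1/p}$ as $N\to\infty$, uniformly in $K$: there are constants $c,C>0$ and $N_0\in\mathbb N$, depending only on $\phi$, $F$, $p$ and $\alpha$, such that $$c\,N^{1/p}\le\|G_{\rm qcl}\|_{\mathcal U^{1,p}}\le C\,N^{1/p}\qquad\text{for all } N\ge N_0\text{ and all } K\in\mathbb N \text{ with } 2\le K\le N/2 .$$ In particular there is no uniform contraction in these spaces: for every $q\in\mathbb R$ there is $N_1$ such that $\|G_{\rm qcl}\|_{\mathcal U^{1,p}}>q$ for all $N\ge N_1$ and all $2\le K\le N/2$. -/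

import Mathlib

open scoped ENNReal

noncomputable section

namespace QC

/-- The lattice spacing `ε = 1 / N`. -/
def eps (N : ℕ) : ℝ := 1 / (N : ℝ)

/-- The space of admissible displacements `(u_{-N}, …, u_N)` with `u_{-N} = u_N = 0`.
A displacement is extended by zero to all of `ℤ`, so that the sites that can carry a nonzero
value are exactly `-N+1, …, N-1`. -/
def Us (N : ℕ) : Submodule ℝ (ℤ → ℝ) where
  carrier := {v | ∀ j : ℤ, (N : ℤ) ≤ |j| → v j = 0}
  add_mem' := by
    intro a b ha hb j hj
    simp [ha j hj, hb j hj]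
  zero_mem' := by
    intro j _
    rfl
  smul_mem' := by
    intro c a ha j hj
    simp [ha j hj]

/-- The backward difference quotient `v'_ℓ = ε⁻¹ (v_ℓ - v_{ℓ-1})`. -/
def diffQ (N : ℕ) (v : ℤ → ℝ) (l : ℤ) : ℝ := (v l - v (l - 1)) / eps N

/-- The `ℓ^p_ε` norm `(ε ∑_{ℓ=-N+1}^{N} |w_ℓ|^p)^{1/p}`, `1 ≤ p < ∞`. -/
def lpNorm (N : ℕ) (p : ℝ) (w : ℤ → ℝ) : ℝ :=
  (eps N * ∑ l ∈ Finset.Icc (-(N : ℤ) + 1) (N : ℤ), |w l| ^ p) ^ (1 / p)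

/-- The `U^{1,p}` norm of a displacement. -/
def normU1 (N : ℕ) (p : ℝ) (v : Us N) : ℝ := lpNorm N p (diffQ N v)

/-- The operator norm of `A` on `U^{1,p}`: the supremum of `‖A v‖ / ‖v‖` over `v ≠ 0`, taken in
`[0, ∞]`. -/
def opNormU1 (N : ℕ) (p : ℝ) (A : Module.End ℝ (Us N)) : ℝ≥0∞ :=
  ⨆ (v : Us N) (_ : v ≠ 0), ENNReal.ofReal (normU1 N p (A v) / normU1 N p v)

/-- `ε⁻² (-v_{j+m} + 2 v_j - v_{j-m})`. -/
def negSecondDiff (N : ℕ) (m : ℤ) (v : ℤ → ℝ) (j : ℤ) : ℝ :=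
  (-v (j + m) + 2 * v j - v (j - m)) / eps N ^ 2

/-- `(L^a v)_j`, the linearized atomistic operator; `a = φ''(F)` and `b = φ''(2F)`. -/
def atomistic (a b : ℝ) (N : ℕ) (v : ℤ → ℝ) (j : ℤ) : ℝ :=
  a * negSecondDiff N 1 v j + b * negSecondDiff N 2 v j

/-- `(L^{qcl} v)_j`, where `L^{qcl} = A_F L` with `A_F = a + 4 b` and `L` the discrete
Laplacian. -/
def localQC (a b : ℝ) (N : ℕ) (v : ℤ → ℝ) (j : ℤ) : ℝ :=
  (a + 4 * b) * negSecondDiff N 1 v j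

/-- The linear operator `L^{qcl} : U → U`; the equations are posed at `j = -N+1, …, N-1`. -/
def Lqcl (a b : ℝ) (N : ℕ) : Module.End ℝ (Us N) where
  toFun v := ⟨fun j => if |j| < (N : ℤ) then localQC a b N v j else 0, by
    intro j hj
    simp [not_lt.mpr hj]⟩
  map_add' v w := by
    ext j
    by_cases h : |j| < (N : ℤ)
    · simp [h, localQC, negSecondDiff]
      ring
    · simp [h]
  map_smul' c v := by
    ext j
    by_cases h : |j| < (N : ℤ)
    · simp [h, localQC, negSecondDiff]
      ring
    · simp [h]

/-- The linear operator `L^{qcf} : U → U`: atomistic in the region `{-K, …, K}` and local QC in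
the rest of `{-N+1, …, N-1}`. -/
def Lqcf (a b : ℝ) (N K : ℕ) : Module.End ℝ (Us N) where
  toFun v := ⟨fun j => if |j| < (N : ℤ) then
      (if |j| ≤ (K : ℤ) then atomistic a b N v j else localQC a b N v j) else 0, by
    intro j hj
    simp [not_lt.mpr hj]⟩
  map_add' v w := by
    ext j
    by_cases h : |j| < (N : ℤ)
    · by_cases h' : |j| ≤ (K : ℤ)
      · simp [h, h', atomistic, negSecondDiff]
        ring
      · simp [h, h', localQC, negSecondDiff]
        ring
    · simp [h]
  map_smul' c v := by
    ext j
    by_cases h : |j| < (N : ℤ)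
    · by_cases h' : |j| ≤ (K : ℤ)
      · simp [h, h', atomistic, negSecondDiff]
        ring
      · simp [h, h', localQC, negSecondDiff]
        ring
    · simp [h]

/-- The iteration matrix `G = I - α (L^{qcl})⁻¹ L^{qcf}`. Here `Ring.inverse` is the two-sided
inverse in the endomorphism ring, see `isUnit_Lqcl`. -/
def Gqcl (a b α : ℝ) (N K : ℕ) : Module.End ℝ (Us N) :=
  1 - α • (Ring.inverse (Lqcl a b N) * Lqcf a b N K)

instance (N : ℕ) : FiniteDimensional ℝ (Us N) := by
  let f : Us N →ₗ[ℝ] (Finset.Icc (-(N : ℤ)) (N : ℤ) → ℝ) :=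
    { toFun := fun v j => (v : ℤ → ℝ) j
      map_add' := fun _ _ => rfl
      map_smul' := fun _ _ => rfl }
  refine FiniteDimensional.of_injective f ?_
  intro v w h
  ext j
  by_cases hj : j ∈ Finset.Icc (-(N : ℤ)) (N : ℤ)
  · exact congrFun h ⟨j, hj⟩
  · have : (N : ℤ) ≤ |j| := by
      rw [Finset.mem_Icc] at hj
      rw [le_abs]
      omega
    rw [v.2 j this, w.2 j this]

/-- The preconditioner `L^{qcl}` is invertible when `A_F ≠ 0`. -/
theorem isUnit_Lqcl {a b : ℝ} (hA : a + 4 * b ≠ 0) {N : ℕ} (hN : 1 ≤ N) :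
    IsUnit (Lqcl a b N) := by
  have hinj : Function.Injective (Lqcl a b N) := by
    rw [← LinearMap.ker_eq_bot, LinearMap.ker_eq_bot']
    intro v hv
    have heps : eps N ≠ 0 := by
      have : (N : ℝ) ≠ 0 := by exact_mod_cast (by omega : N ≠ 0)
      simp [eps, this]
    have hrec : ∀ j : ℤ, |j| < (N : ℤ) →
        (v : ℤ → ℝ) (j + 1) = 2 * (v : ℤ → ℝ) j - (v : ℤ → ℝ) (j - 1) := by
      intro j hj
      have h1 : (Lqcl a b N v : ℤ → ℝ) j = 0 := by rw [hv]; rfl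
      have h2 : (a + 4 * b) * negSecondDiff N 1 v j = 0 := by
        simpa [Lqcl, hj, localQC] using h1
      have h3 := (mul_eq_zero.mp h2).resolve_left hA
      unfold negSecondDiff at h3
      have h4 := (div_eq_zero_iff.mp h3).resolve_right (pow_ne_zero 2 heps)
      linarith
    have h0 : (v : ℤ → ℝ) (-(N : ℤ)) = 0 := v.2 _ (by simp)
    have hN0 : (v : ℤ → ℝ) (N : ℤ) = 0 := v.2 _ (by simp)
    set s := (v : ℤ → ℝ) (-(N : ℤ) + 1) with hs
    have key : ∀ k : ℕ, k + 1 ≤ 2 * N →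
        (v : ℤ → ℝ) (-(N : ℤ) + k) = k * s ∧
          (v : ℤ → ℝ) (-(N : ℤ) + k + 1) = (k + 1) * s := by
      intro k
      induction k with
      | zero =>
        intro _
        simp [h0, hs]
      | succ k ih =>
        intro hk
        obtain ⟨h1, h2⟩ := ih (by omega)
        have hr := hrec (-(N : ℤ) + k + 1) (by rw [abs_lt]; omega)
        rw [h2, add_sub_cancel_right, h1] at hr
        have e : (-(N : ℤ) + ((k + 1 : ℕ) : ℤ)) = -(N : ℤ) + k + 1 := by push_cast; ring
        rw [e]
        refine ⟨by rw [h2]; push_cast; ring, by rw [hr]; push_cast; ring⟩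
    have hs0 : s = 0 := by
      have h := (key (2 * N - 1) (by omega)).2
      have e : (-(N : ℤ) + ((2 * N - 1 : ℕ) : ℤ) + 1) = N := by omega
      rw [e, hN0] at h
      have hp : (0 : ℝ) < ((2 * N - 1 : ℕ) : ℝ) + 1 := by positivity
      rcases mul_eq_zero.mp h.symm with h' | h'
      · exact absurd h' hp.ne'
      · exact h'
    ext j
    by_cases hj : |j| < (N : ℤ)
    · rw [abs_lt] at hj
      have h := (key (j + N).toNat (by omega)).1
      have e : (-(N : ℤ) + ((j + N).toNat : ℤ)) = j := by omega
      rw [e, hs0, mul_zero] at h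
      exact h
    · exact v.2 j (not_lt.mp hj)
  rw [Module.End.isUnit_iff]
  exact ⟨hinj, LinearMap.injective_iff_surjective.mp hinj⟩

end QC

end

noncomputable section

namespace QC

/-! Write `r` and `q` for the strains of `v` and `G v`, and `S` for the second difference of `r`.
The next-nearest-neighbour term of the atomistic operator is the local one plus a difference `S
(j+1) - S j`, so the equation for `G v` can be summed: on the strain indices, `A_F q = (1-α) A_F r -
α b S ∘ clamp + const`. Composing with `clamp` freezes `S` outside the atomistic region, and the
constant is fixed by `∑ q = 0`.

Upper bound: `S` at the two interface points is a pointwise value of the strains, costing `N^{1/p}`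
against the `ℓ^p` norm, and it is spread over order `N` sites. Lower bound: a bump at `K+1` has norm
of order `N^{-1/p}`, yet it makes `q` jump by a fixed amount between the two continuum regions, so
`q` has order 1 on a positive fraction of the sites. -/

/-- The second difference `r_{l+1} - 2 r_l + r_{l-1}`. -/
def secondDiff (r : ℤ → ℝ) (l : ℤ) : ℝ := r (l + 1) - 2 * r l + r (l - 1)

/-- The projection of `l` to the interval `{-K, …, K+1}`. -/
def clamp (K : ℕ) (l : ℤ) : ℤ := max (-(K : ℤ)) (min l (K + 1))

theorem eps_pos {N : ℕ} (hN : 1 ≤ N) : 0 < eps N := by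
  have : (0 : ℝ) < N := by exact_mod_cast hN
  unfold eps
  positivity

/-! ### The strain equation of the iteration -/

theorem Lqcl_Gqcl {a b α : ℝ} (hA : a + 4 * b ≠ 0) {N K : ℕ} (hN : 1 ≤ N) (v : Us N) :
    Lqcl a b N (Gqcl a b α N K v) = Lqcl a b N v - α • Lqcf a b N K v := by
  have h : Lqcl a b N (Ring.inverse (Lqcl a b N) (Lqcf a b N K v)) = Lqcf a b N K v :=
    LinearMap.congr_fun (Ring.mul_inverse_cancel _ (isUnit_Lqcl hA hN)) _
  have hG : Gqcl a b α N K v = v - α • Ring.inverse (Lqcl a b N) (Lqcf a b N K v) := rfl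
  rw [hG, map_sub, map_smul, h]

/-- The equation satisfied by the strains of `G v`, at a single site. -/
theorem diffQ_Gqcl_step {a b α : ℝ} (hA : a + 4 * b ≠ 0) {N K : ℕ} (hN : 1 ≤ N)
    (v : Us N) {j : ℤ} (hj : |j| < (N : ℤ)) :
    (a + 4 * b) * (diffQ N (Gqcl a b α N K v) (j + 1) - diffQ N (Gqcl a b α N K v) j) =
      (1 - α) * (a + 4 * b) * (diffQ N v (j + 1) - diffQ N v j) -
        α * b * (secondDiff (diffQ N v) (clamp K (j + 1)) -
          secondDiff (diffQ N v) (clamp K j)) := by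
  have he := (eps_pos hN).ne'
  have h : (Lqcl a b N (Gqcl a b α N K v) : ℤ → ℝ) j =
      (Lqcl a b N v : ℤ → ℝ) j - α * (Lqcf a b N K v : ℤ → ℝ) j := by
    rw [Lqcl_Gqcl hA hN]
    rfl
  generalize Gqcl a b α N K v = w at h ⊢
  have e2 : j + 1 + 1 = j + 2 := by ring
  have e3 : j - 1 - 1 = j - 2 := by ring
  have e4 : j + 2 - 1 = j + 1 := by ring
  -- Inside, `r (j+2) + r (j+1) - r j - r (j-1)` equals `4 (r (j+1) - r j)` plus the increment of
  -- the second difference. Outside, both clamped indices coincide and the last term vanishes.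
  by_cases hK : |j| ≤ (K : ℤ)
  · have hc1 : clamp K j = j := by
      rw [abs_le] at hK
      unfold clamp
      omega
    have hc2 : clamp K (j + 1) = j + 1 := by
      rw [abs_le] at hK
      unfold clamp
      omega
    simp only [Lqcl, Lqcf, LinearMap.coe_mk, AddHom.coe_mk, hj, hK, if_true, localQC, atomistic,
      negSecondDiff] at h
    rw [hc1, hc2]
    simp only [secondDiff, diffQ, add_sub_cancel_right, e2, e3, e4]
    field_simp at h ⊢
    linear_combination -h
  · have hc : clamp K (j + 1) = clamp K j := by
      rw [abs_le] at hK
      unfold clamp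
      omega
    simp only [Lqcl, Lqcf, LinearMap.coe_mk, AddHom.coe_mk, hj, hK, if_true, if_false, localQC,
      negSecondDiff] at h
    rw [hc]
    simp only [diffQ, add_sub_cancel_right]
    field_simp at h ⊢
    linear_combination -(a + 4 * b) * h

/-- Performs the summation: the sites `|j| < N` are exactly the links between consecutive strain
indices. -/
theorem eq_of_step_eq {N : ℕ} {T : ℤ → ℝ} (hT : ∀ j : ℤ, |j| < (N : ℤ) → T (j + 1) = T j)
    {l m : ℤ} (hl : l ∈ Finset.Icc (-(N : ℤ) + 1) N) (hm : m ∈ Finset.Icc (-(N : ℤ) + 1) N) :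
    T l = T m := by
  have key : ∀ l : ℤ, -(N : ℤ) + 1 ≤ l → l ≤ N → T l = T (-(N : ℤ) + 1) := by
    intro l hl
    induction l, hl using Int.leInduction with
    | base => exact fun _ => rfl
    | succ k hk ih =>
      intro h
      rw [hT k (by rw [abs_lt]; omega), ih (by omega)]
  rw [Finset.mem_Icc] at hl hm
  rw [key l hl.1 hl.2, key m hm.1 hm.2]

/-- The strains of `G v`, up to a constant. -/
theorem diffQ_Gqcl_sub {a b α : ℝ} (hA : a + 4 * b ≠ 0) {N K : ℕ} (hN : 1 ≤ N)
    (v : Us N) {l m : ℤ} (hl : l ∈ Finset.Icc (-(N : ℤ) + 1) N)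
    (hm : m ∈ Finset.Icc (-(N : ℤ) + 1) N) :
    (a + 4 * b) * (diffQ N (Gqcl a b α N K v) l - diffQ N (Gqcl a b α N K v) m) =
      (1 - α) * (a + 4 * b) * (diffQ N v l - diffQ N v m) -
        α * b * (secondDiff (diffQ N v) (clamp K l) - secondDiff (diffQ N v) (clamp K m)) := by
  have h := eq_of_step_eq (T := fun l => (a + 4 * b) * diffQ N (Gqcl a b α N K v) l -
    (1 - α) * (a + 4 * b) * diffQ N v l + α * b * secondDiff (diffQ N v) (clamp K l))
    (fun j hj => by
      have := diffQ_Gqcl_step (K := K) (α := α) hA hN v hj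
      linear_combination this) hl hm
  linear_combination h

/-! ### Strains have mean zero -/

/-- The sum telescopes between the two zero boundary values. This determines the constant of
summation. -/
theorem sum_diffQ (N : ℕ) (v : Us N) :
    ∑ l ∈ Finset.Icc (-(N : ℤ) + 1) N, diffQ N v l = 0 := by
  have key : ∀ n : ℕ, ∑ l ∈ Finset.Icc (-(N : ℤ) + 1) (-(N : ℤ) + n), diffQ N v l =
      (v : ℤ → ℝ) (-(N : ℤ) + n) / eps N := by
    intro n
    induction n with
    | zero =>
      have h : (v : ℤ → ℝ) (-(N : ℤ)) = 0 := v.2 _ (by simp)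
      simp [h]
    | succ n ih =>
      have hI : Finset.Icc (-(N : ℤ) + 1) (-(N : ℤ) + (n + 1 : ℕ)) =
          insert (-(N : ℤ) + (n + 1 : ℕ)) (Finset.Icc (-(N : ℤ) + 1) (-(N : ℤ) + n)) := by
        ext x
        simp only [Finset.mem_insert, Finset.mem_Icc]
        omega
      have e : -(N : ℤ) + (n + 1 : ℕ) - 1 = -(N : ℤ) + n := by omega
      rw [hI, Finset.sum_insert (by simp), ih, diffQ, e]
      ring
  have h := key (2 * N)
  have e : -(N : ℤ) + (2 * N : ℕ) = N := by omega
  rw [e, v.2 (N : ℤ) (by simp), zero_div] at h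
  exact h

theorem card_strains (N : ℕ) : (Finset.Icc (-(N : ℤ) + 1) N).card = 2 * N := by
  rw [Int.card_Icc]
  omega

/-- Strains of oscillation at most `B` are bounded by `B`, since they have mean zero. -/
theorem abs_diffQ_le_of_osc {N : ℕ} (hN : 1 ≤ N) (w : Us N) {B : ℝ}
    (hB : ∀ l ∈ Finset.Icc (-(N : ℤ) + 1) N, ∀ m ∈ Finset.Icc (-(N : ℤ) + 1) N,
      |diffQ N w l - diffQ N w m| ≤ B) {l : ℤ} (hl : l ∈ Finset.Icc (-(N : ℤ) + 1) N) :
    |diffQ N w l| ≤ B := by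
  have hN' : (0 : ℝ) < 2 * N := by
    have : (0 : ℝ) < N := by exact_mod_cast hN
    positivity
  -- Averaging over `m` removes the second strain, leaving `diffQ N w l` as a mean of differences.
  have h1 : ∑ m ∈ Finset.Icc (-(N : ℤ) + 1) N, (diffQ N w l - diffQ N w m) =
      2 * N * diffQ N w l := by
    rw [Finset.sum_sub_distrib, sum_diffQ, Finset.sum_const, card_strains]
    simp
  have h2 : |∑ m ∈ Finset.Icc (-(N : ℤ) + 1) N, (diffQ N w l - diffQ N w m)| ≤ 2 * N * B := by
    refine (Finset.abs_sum_le_sum_abs _ _).trans ((Finset.sum_le_card_nsmul _ _ B (hB l hl)).trans ?_)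
    rw [card_strains]
    simp
  rw [h1, abs_mul, abs_of_pos hN'] at h2
  exact le_of_mul_le_mul_left h2 hN'

/-! ### Comparison of the discrete `ℓ^p` norm with pointwise values -/

theorem lpNorm_nonneg (N : ℕ) (p : ℝ) (w : ℤ → ℝ) : 0 ≤ lpNorm N p w := by
  unfold lpNorm eps
  positivity

/-- A single term of the sum has weight `1/N`; this is the source of the factor `N^{1/p}`. -/
theorem abs_le_lpNorm {N : ℕ} (hN : 1 ≤ N) {p : ℝ} (hp : 1 ≤ p) (w : ℤ → ℝ) {l : ℤ}
    (hl : l ∈ Finset.Icc (-(N : ℤ) + 1) N) : |w l| ≤ (N : ℝ) ^ (1 / p) * lpNorm N p w := by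
  have hN' : (0 : ℝ) < N := by exact_mod_cast hN
  have hp0 : p ≠ 0 := by positivity
  have hS : 0 ≤ ∑ l ∈ Finset.Icc (-(N : ℤ) + 1) N, |w l| ^ p :=
    Finset.sum_nonneg fun _ _ => by positivity
  rw [lpNorm, ← Real.mul_rpow hN'.le (mul_nonneg (eps_pos hN).le hS), eps, ← mul_assoc,
    mul_one_div_cancel hN'.ne', one_mul]
  calc |w l| = (|w l| ^ p) ^ (1 / p) := by
        rw [one_div, Real.rpow_rpow_inv (abs_nonneg _) hp0]
    _ ≤ _ := Real.rpow_le_rpow (by positivity)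
        (Finset.single_le_sum (f := fun l => |w l| ^ p) (fun _ _ => by positivity) hl)
        (by positivity)

/-- There are `2N` terms of weight `1/N`, and `2^{1/p} ≤ 2`. -/
theorem lpNorm_le_of_abs_le {N : ℕ} (hN : 1 ≤ N) {p : ℝ} (hp : 1 ≤ p) {w : ℤ → ℝ} {B : ℝ}
    (hB0 : 0 ≤ B) (hB : ∀ l ∈ Finset.Icc (-(N : ℤ) + 1) N, |w l| ≤ B) :
    lpNorm N p w ≤ 2 * B := by
  have hN' : (0 : ℝ) < N := by exact_mod_cast hN
  have hp0 : p ≠ 0 := by positivity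
  have h1 : ∑ l ∈ Finset.Icc (-(N : ℤ) + 1) N, |w l| ^ p ≤ 2 * N * B ^ p := by
    refine (Finset.sum_le_card_nsmul _ _ (B ^ p) fun l hl =>
      Real.rpow_le_rpow (abs_nonneg _) (hB l hl) (by positivity)).trans ?_
    rw [card_strains]
    simp
  have h2 : eps N * ∑ l ∈ Finset.Icc (-(N : ℤ) + 1) N, |w l| ^ p ≤ 2 * B ^ p := by
    refine (mul_le_mul_of_nonneg_left h1 (eps_pos hN).le).trans (le_of_eq ?_)
    unfold eps
    field_simp
  have hS : 0 ≤ ∑ l ∈ Finset.Icc (-(N : ℤ) + 1) N, |w l| ^ p :=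
    Finset.sum_nonneg fun _ _ => by positivity
  calc lpNorm N p w ≤ (2 * B ^ p) ^ (1 / p) :=
        Real.rpow_le_rpow (mul_nonneg (eps_pos hN).le hS) h2 (by positivity)
    _ = 2 ^ (1 / p) * B := by
        rw [Real.mul_rpow (by norm_num) (by positivity), one_div, Real.rpow_rpow_inv hB0 hp0]
    _ ≤ 2 * B := by
        refine mul_le_mul_of_nonneg_right ?_ hB0
        calc (2 : ℝ) ^ (1 / p) ≤ 2 ^ (1 : ℝ) :=
              Real.rpow_le_rpow_of_exponent_le (by norm_num)
                ((div_le_one (by positivity)).2 hp)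
          _ = 2 := Real.rpow_one _

theorem le_lpNorm_of_le_abs {N n : ℕ} (hN : 1 ≤ N) {p : ℝ} (hp : 1 ≤ p) {w : ℤ → ℝ} {B : ℝ}
    (hB0 : 0 ≤ B) {s : Finset ℤ} (hs : s ⊆ Finset.Icc (-(N : ℤ) + 1) N) (hn : n ≤ s.card)
    (hB : ∀ l ∈ s, B ≤ |w l|) : ((n : ℝ) / N) ^ (1 / p) * B ≤ lpNorm N p w := by
  have hp0 : p ≠ 0 := by positivity
  have h1 : (n : ℝ) * B ^ p ≤ ∑ l ∈ Finset.Icc (-(N : ℤ) + 1) N, |w l| ^ p := by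
    calc (n : ℝ) * B ^ p ≤ s.card * B ^ p := by gcongr
      _ = s.card • B ^ p := by simp
      _ ≤ ∑ l ∈ s, |w l| ^ p := Finset.card_nsmul_le_sum _ _ _ fun l hl =>
          Real.rpow_le_rpow hB0 (hB l hl) (by positivity)
      _ ≤ _ := Finset.sum_le_sum_of_subset_of_nonneg hs fun _ _ _ => by positivity
  calc ((n : ℝ) / N) ^ (1 / p) * B = (n / N * B ^ p) ^ (1 / p) := by
        rw [Real.mul_rpow (by positivity) (by positivity), one_div, Real.rpow_rpow_inv hB0 hp0]
    _ = (eps N * (n * B ^ p)) ^ (1 / p) := by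
        unfold eps
        ring_nf
    _ ≤ _ := Real.rpow_le_rpow (mul_nonneg (eps_pos hN).le (by positivity))
        (mul_le_mul_of_nonneg_left h1 (eps_pos hN).le) (by positivity)

/-- The bound covers every integer, since second differences may reach beyond the strain range,
where the zero extension has no strain. -/
theorem abs_diffQ_le {N : ℕ} (hN : 1 ≤ N) {p : ℝ} (hp : 1 ≤ p) (v : Us N) (l : ℤ) :
    |diffQ N v l| ≤ (N : ℝ) ^ (1 / p) * normU1 N p v := by
  by_cases hl : l ∈ Finset.Icc (-(N : ℤ) + 1) N
  · exact abs_le_lpNorm hN hp _ hl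
  · have h1 : (v : ℤ → ℝ) l = 0 := v.2 _ (by rw [Finset.mem_Icc] at hl; rw [le_abs]; omega)
    have h2 : (v : ℤ → ℝ) (l - 1) = 0 :=
      v.2 _ (by rw [Finset.mem_Icc] at hl; rw [le_abs]; omega)
    rw [diffQ, h1, h2, sub_zero, zero_div, abs_zero]
    exact mul_nonneg (by positivity) (lpNorm_nonneg _ _ _)

theorem abs_secondDiff_le {r : ℤ → ℝ} {M : ℝ} (hr : ∀ l, |r l| ≤ M) (l : ℤ) :
    |secondDiff r l| ≤ 4 * M := by
  have h1 := abs_le.1 (hr (l + 1))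
  have h2 := abs_le.1 (hr l)
  have h3 := abs_le.1 (hr (l - 1))
  unfold secondDiff
  rw [abs_le]
  constructor <;> linarith

/-! ### Upper bound -/

theorem opNormU1_Gqcl_le {a b α : ℝ} (hA : 0 < a + 4 * b) {p : ℝ} (hp : 1 ≤ p) {N K : ℕ} (hN : 1 ≤ N) :
    opNormU1 N p (Gqcl a b α N K) ≤
      ENNReal.ofReal (2 * (2 * |1 - α| + 8 * |α * b| / (a + 4 * b)) * (N : ℝ) ^ (1 / p)) := by
  refine iSup₂_le fun v _ => ENNReal.ofReal_le_ofReal ?_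
  have hv : 0 ≤ normU1 N p v := lpNorm_nonneg _ _ _
  refine div_le_of_le_mul₀ hv (by positivity) ?_
  set M := (N : ℝ) ^ (1 / p) * normU1 N p v with hM
  have hM0 : 0 ≤ M := by positivity
  have hr : ∀ l, |diffQ N v l| ≤ M := abs_diffQ_le hN hp v
  have hosc : ∀ l ∈ Finset.Icc (-(N : ℤ) + 1) N, ∀ m ∈ Finset.Icc (-(N : ℤ) + 1) N,
      |diffQ N (Gqcl a b α N K v) l - diffQ N (Gqcl a b α N K v) m| ≤
        (2 * |1 - α| + 8 * |α * b| / (a + 4 * b)) * M := by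
    intro l hl m hm
    have h := diffQ_Gqcl_sub (K := K) (α := α) hA.ne' hN v hl hm
    have h1 : |diffQ N v l - diffQ N v m| ≤ 2 * M :=
      (abs_sub _ _).trans (by linarith [hr l, hr m])
    have h2 : |secondDiff (diffQ N v) (clamp K l) - secondDiff (diffQ N v) (clamp K m)| ≤
        8 * M :=
      (abs_sub _ _).trans (by
        linarith [abs_secondDiff_le hr (clamp K l), abs_secondDiff_le hr (clamp K m)])
    refine le_of_mul_le_mul_left ?_ hA
    rw [← abs_of_pos hA, ← abs_mul, abs_of_pos hA, h]
    calc _ ≤ |(1 - α) * (a + 4 * b) * (diffQ N v l - diffQ N v m)| + |α * b *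
          (secondDiff (diffQ N v) (clamp K l) - secondDiff (diffQ N v) (clamp K m))| :=
          abs_sub _ _
      _ = |1 - α| * (a + 4 * b) * |diffQ N v l - diffQ N v m| + |α * b| *
          |secondDiff (diffQ N v) (clamp K l) - secondDiff (diffQ N v) (clamp K m)| := by
          rw [abs_mul, abs_mul, abs_of_pos hA, abs_mul (α * b)]
      _ ≤ |1 - α| * (a + 4 * b) * (2 * M) + |α * b| * (8 * M) := by gcongr
      _ = _ := by field_simp
  have h := lpNorm_le_of_abs_le hN hp (by positivity)
    fun l hl => abs_diffQ_le_of_osc hN (Gqcl a b α N K v) hosc hl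
  calc normU1 N p (Gqcl a b α N K v) ≤ _ := h
    _ = _ := by rw [hM]; ring

/-! ### Lower bound -/

/-- The displacement with value `ε` at site `k` and zero elsewhere. -/
def bump (N : ℕ) (k : ℤ) (hk : |k| < (N : ℤ)) : Us N :=
  ⟨Pi.single k (eps N), fun j hj => by
    rw [Pi.single_apply, if_neg]
    rintro rfl
    omega⟩

theorem diffQ_bump {N : ℕ} (hN : 1 ≤ N) {k : ℤ} (hk : |k| < (N : ℤ)) (l : ℤ) :
    diffQ N (bump N k hk) l = if l = k then 1 else if l = k + 1 then -1 else 0 := by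
  have he := (eps_pos hN).ne'
  have e : l - 1 = k ↔ l = k + 1 := by omega
  simp only [diffQ, bump, Pi.single_apply, e]
  by_cases h1 : l = k
  · have h2 : ¬ l = k + 1 := by omega
    simp only [h1, if_true]
    simp [he]
  · by_cases h2 : l = k + 1
    · simp [h2, he]
    · simp [h1, h2]

theorem normU1_bump {N : ℕ} (hN : 1 ≤ N) {p : ℝ} (hp : 1 ≤ p) {k : ℤ} (hk : |k| < (N : ℤ)) :
    normU1 N p (bump N k hk) = (2 / (N : ℝ)) ^ (1 / p) := by
  have hp0 : p ≠ 0 := by positivity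
  have hk' := abs_lt.1 hk
  have h : ∑ l ∈ Finset.Icc (-(N : ℤ) + 1) N, |diffQ N (bump N k hk) l| ^ p = 2 := by
    rw [← Finset.sum_subset (s₁ := {k, k + 1}), Finset.sum_pair (by omega)]
    · simp only [diffQ_bump hN]
      norm_num
    · intro x
      simp only [Finset.mem_insert, Finset.mem_singleton, Finset.mem_Icc]
      omega
    · intro x _ hx
      simp only [Finset.mem_insert, Finset.mem_singleton, not_or] at hx
      rw [diffQ_bump hN, if_neg hx.1, if_neg hx.2, abs_zero, Real.zero_rpow hp0]
  rw [normU1, lpNorm, h, eps]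
  ring_nf

theorem le_opNormU1_Gqcl {a b α : ℝ} (hA : 0 < a + 4 * b) {p : ℝ} (hp : 1 ≤ p)
    {N K : ℕ} (hN : 8 ≤ N) (hK : 2 ≤ K) (hKN : 2 * K ≤ N) :
    ENNReal.ofReal (3 * |α * b| / (2 * (a + 4 * b)) * (1 / 8) ^ (1 / p) * (N : ℝ) ^ (1 / p)) ≤
      opNormU1 N p (Gqcl a b α N K) := by
  have hN1 : 1 ≤ N := by omega
  have hN' : (0 : ℝ) < N := by exact_mod_cast hN1
  have hk : |(K : ℤ) + 1| < (N : ℤ) := by rw [abs_lt]; omega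
  -- The strains are `1` at `K+1` and `-1` at `K+2`. The frozen second difference is thus `-3` on
  -- the right and `0` on the left, while the strain itself vanishes for `l ≤ -K` and `l ≥ K+3`.
  set v := bump N (K + 1) hk with hv
  -- Half of the jump `3 |α b| / A_F` of `q` between the two sides.
  set d := 3 * |α * b| / (2 * (a + 4 * b)) with hd
  have hd0 : 0 ≤ d := by positivity
  have hnv := normU1_bump hN1 hp hk
  have hnv0 : 0 < normU1 N p v := by
    rw [hnv]
    positivity
  have hv0 : v ≠ 0 := by
    intro h
    have h1 := diffQ_bump hN1 hk (K + 1)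
    rw [← hv, h] at h1
    simp [diffQ] at h1
  refine le_trans (ENNReal.ofReal_le_ofReal ?_)
    (le_iSup₂ (f := fun (v : Us N) (_ : v ≠ 0) =>
      ENNReal.ofReal (normU1 N p (Gqcl a b α N K v) / normU1 N p v)) v hv0)
  set q := diffQ N (Gqcl a b α N K v) with hq
  set n := N - K - 2 with hn
  have hr : ∀ l : ℤ, diffQ N v l = if l = K + 1 then 1 else if l = K + 1 + 1 then -1 else 0 :=
    diffQ_bump hN1 hk
  have hsub : ∀ l m : ℤ, -(N : ℤ) + 1 ≤ l → l ≤ -K → (K : ℤ) + 3 ≤ m → m ≤ N →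
      2 * d ≤ |q l - q m| := by
    intro l m hl hl' hm hm'
    have h := diffQ_Gqcl_sub (K := K) (α := α) hA.ne' hN1 v
      (l := l) (m := m) (by rw [Finset.mem_Icc]; omega) (by rw [Finset.mem_Icc]; omega)
    have c1 : clamp K l = -K := by unfold clamp; omega
    have c2 : clamp K m = K + 1 := by unfold clamp; omega
    have s1 : secondDiff (diffQ N v) (-K) = 0 := by
      simp only [secondDiff, hr]
      rw [if_neg (by omega), if_neg (by omega), if_neg (by omega), if_neg (by omega),
        if_neg (by omega), if_neg (by omega)]
      ring
    have s2 : secondDiff (diffQ N v) (K + 1) = -3 := by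
      simp only [secondDiff, hr]
      norm_num
      omega
    have r1 : diffQ N v l = 0 := by rw [hr, if_neg (by omega), if_neg (by omega)]
    have r2 : diffQ N v m = 0 := by rw [hr, if_neg (by omega), if_neg (by omega)]
    rw [c1, c2, s1, s2, r1, r2, ← hq] at h
    have h' : q l - q m = -(3 * (α * b) / (a + 4 * b)) := by
      rw [← neg_div, eq_div_iff hA.ne']
      linear_combination h
    rw [h', abs_neg, abs_div, abs_mul, abs_of_pos hA, hd]
    refine le_of_eq ?_
    norm_num
    field_simp
  have hconst : ∃ s : Finset ℤ, s ⊆ Finset.Icc (-(N : ℤ) + 1) N ∧ n ≤ s.card ∧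
      ∀ l ∈ s, d ≤ |q l| := by
    -- Either `|q| ≥ d` on the whole left side, or one left value is smaller and the gap `2d` forces
    -- `|q| ≥ d` on the whole right side, which has the fewer sites, `n = N - K - 2`.
    by_cases hc : ∀ l ∈ Finset.Icc (-(N : ℤ) + 1) (-K), d ≤ |q l|
    · refine ⟨_, Finset.Icc_subset_Icc le_rfl (by omega), ?_, hc⟩
      rw [Int.card_Icc]
      omega
    · push Not at hc
      obtain ⟨l, hl, hlt⟩ := hc
      rw [Finset.mem_Icc] at hl
      refine ⟨Finset.Icc (K + 3) N, Finset.Icc_subset_Icc (by omega) le_rfl, ?_, ?_⟩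
      · rw [Int.card_Icc]
        omega
      · intro m hm
        rw [Finset.mem_Icc] at hm
        linarith [hsub l m hl.1 hl.2 hm.1 hm.2, abs_sub (q l) (q m)]
  obtain ⟨s, hs, hcard, hsd⟩ := hconst
  have hlow : ((n : ℝ) / N) ^ (1 / p) * d ≤ normU1 N p (Gqcl a b α N K v) :=
    le_lpNorm_of_le_abs hN1 hp hd0 hs hcard hsd
  -- `K ≤ N/2` gives `n ≥ N/2 - 2`, which is at least `N/4` once `N ≥ 8`. Dividing `1/4` by the
  -- `2/N` of the bump norm produces the `1/8`.
  have hn4 : (1 : ℝ) / 4 ≤ n / N := by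
    rw [le_div_iff₀ hN']
    have : (N : ℝ) ≤ 4 * n := by exact_mod_cast (by omega : N ≤ 4 * n)
    linarith
  rw [le_div_iff₀ hnv0, hnv]
  calc d * (1 / 8) ^ (1 / p) * (N : ℝ) ^ (1 / p) * (2 / (N : ℝ)) ^ (1 / p)
      = (1 / 4 : ℝ) ^ (1 / p) * d := by
        rw [mul_assoc, mul_assoc, ← Real.mul_rpow (by positivity) (by positivity),
          ← Real.mul_rpow (by positivity) (by positivity), mul_comm]
        congr 2
        field_simp
        norm_num
    _ ≤ ((n : ℝ) / N) ^ (1 / p) * d := by gcongr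
    _ ≤ _ := hlow

end QC

end

theorem mainTheorem6 (φ : ℝ → ℝ) (F : ℝ) (hF : 0 < F)
    (hφF : ContDiffAt ℝ 2 φ F) (hφ2F : ContDiffAt ℝ 2 φ (2 * F))
    (hAF : 0 < iteratedDeriv 2 φ F + 4 * iteratedDeriv 2 φ (2 * F))
    (hne : iteratedDeriv 2 φ (2 * F) ≠ 0)
    (p : ℝ) (hp : 1 ≤ p) (α : ℝ) (hα : 0 < α) :
    (∃ c C : ℝ, 0 < c ∧ 0 < C ∧ ∃ N₀ : ℕ, ∀ N K : ℕ, N₀ ≤ N → 2 ≤ K → (K : ℝ) ≤ (N : ℝ) / 2 →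
      ENNReal.ofReal (c * (N : ℝ) ^ (1 / p)) ≤
          QC.opNormU1 N p
            (QC.Gqcl (iteratedDeriv 2 φ F) (iteratedDeriv 2 φ (2 * F)) α N K) ∧
        QC.opNormU1 N p
            (QC.Gqcl (iteratedDeriv 2 φ F) (iteratedDeriv 2 φ (2 * F)) α N K) ≤
          ENNReal.ofReal (C * (N : ℝ) ^ (1 / p))) ∧
    (∀ q : ℝ, ∃ N₀ : ℕ, ∀ N K : ℕ, N₀ ≤ N → 2 ≤ K → (K : ℝ) ≤ (N : ℝ) / 2 →
      ENNReal.ofReal q <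
        QC.opNormU1 N p
          (QC.Gqcl (iteratedDeriv 2 φ F) (iteratedDeriv 2 φ (2 * F)) α N K)) := by
  generalize iteratedDeriv 2 φ F = a at *
  generalize iteratedDeriv 2 φ (2 * F) = b at *
  have hp0 : 0 < p := by positivity
  have hαb : 0 < |α * b| := abs_pos.2 (mul_ne_zero hα.ne' hne)
  set c := 3 * |α * b| / (2 * (a + 4 * b)) * (1 / 8) ^ (1 / p) with hc
  have hc0 : 0 < c := by positivity
  have hnat : ∀ N K : ℕ, (K : ℝ) ≤ (N : ℝ) / 2 → 2 * K ≤ N := by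
    intro N K h
    have : (2 : ℝ) * K ≤ N := by linarith
    exact_mod_cast this
  refine ⟨⟨c, 2 * (2 * |1 - α| + 8 * |α * b| / (a + 4 * b)), hc0, by positivity, 8,
    fun N K hN hK hKN => ?_⟩, fun q => ?_⟩
  · have h := hnat N K hKN
    exact ⟨QC.le_opNormU1_Gqcl hAF hp hN hK h,
      QC.opNormU1_Gqcl_le hAF hp (by omega)⟩
  · have hlim : Filter.Tendsto (fun N : ℕ => c * (N : ℝ) ^ (1 / p)) Filter.atTop Filter.atTop :=
      ((tendsto_rpow_atTop (by positivity)).comp tendsto_natCast_atTop_atTop).const_mul_atTop hc0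
    -- The maximum with `0` handles negative `q`, for which `ENNReal.ofReal q = 0`.
    obtain ⟨N₁, hN₁⟩ := Filter.eventually_atTop.1 (hlim.eventually_gt_atTop (max q 0))
    refine ⟨max N₁ 8, fun N K hN hK hKN => ?_⟩
    have h := hN₁ N (le_of_max_le_left hN)
    exact ((ENNReal.ofReal_lt_ofReal_iff ((le_max_right _ _).trans_lt h)).2
      ((le_max_left _ _).trans_lt h)).trans_le
        (QC.le_opNormU1_Gqcl hAF hp (le_of_max_le_right hN) hK (hnat N K hKN))
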